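/- Let $N$ be a number of patterns and $D\ge 1$ a dimension. A generalized negentropy is a function $\Omega:\triangle_N\to\mathbb R$ on the probability simplex that vanishes at the one-hot vectors $e_1,\dots,e_N$, is strictly convex, and is invariant under permutations of the coordinates. Put $\Omega^*(\theta)=\sup_{y\in\triangle_N}\theta^\top y-\Omega(y)$, $L_\Omega(\theta,y)=\Omega(y)+\Omega^*(\theta)-\theta^\top y$ and $\hat y_\Omega(\theta)=\arg\max_{y\in\triangle_N}\theta^\top y-\Omega(y)$. The loss $L_\Omega$ has margin $m$ if $m$ is the smallest number $\ge 0$ such that, for all $\theta\in\mathbb R^N$ and all $i$, $L_\Omega(\theta,e_i)=0$ if and only if $\theta_i-\theta_j\ge m$ for all $j\neq i$. The Hopfield–Fenchel–Young (HFY) network with inverse temperature $\beta>0$ and pattern matrix $X\in\mathbb R^{N\times D}$, whose rows are the patterns $x_1,\dots,x_N$, has the update rule $q^{(t+1)}=X^\top\hat y_\Omega(\beta Xq^{(t)})$. It stores its $N$ patterns and retrieves each exactly in one iteration under $\varepsilon$-perturbations if the patterns are pairwise distinct and, for every $i$ and every $q^{(0)}$ with $\|q^{(0)}-x_i\|\le\varepsilon$,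 one has $q^{(t)}=x_i$ for all $t\ge 1$. The patterns are optimally placed on the sphere of radius $M$ if they are points of this sphere whose smallest pairwise angle is the largest possible for $N$ points of the sphere. There are absolute constants $c>0$ and $C>0$ such that the following holds for all $D\ge1$, all $N\ge 0$, all $M,\beta>0$, all $\varepsilon\ge 0$, and all generalized negentropies $\Omega$ on $\triangle_N$ whose loss $L_\Omega$ has margin $m$. 1. If $N\le c\,(2/\sqrt3)^D$, $M^2>2m/\beta$ and $\varepsilon\le\frac M4-\frac m{2\beta M}$, then optimal placements of $N$ patterns on the sphere of radius $M$ exist, and for every such placement the HFY network stores the $N$ patterns and retrieves each exactly in one iteration under $\varepsilon$-perturbations. 2. Let $0\le p\le 1$ and $\zeta>0$. If the $N$ patterns are drawn independently from the uniform distribution on the sphere of radius $M$, if $N\le C\sqrt p\,\zeta^{(D-1)/2}$ and $\varepsilon\le\frac M2\left(1-\cos\frac1\zeta\right)-\frac m{2\beta M}$, then with probability at least $1-p$ the HFY network stores the $N$ patterns and retrieves each exactly in one iteration under $\varepsilon$-perturbations. -/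

import Mathlib

open MeasureTheory

noncomputable section

/-- A generalized negentropy on the probability simplex with `N` vertices: it vanishes at the one-hot
vectors, is strictly convex, and is invariant under permutations of the coordinates. Only the values
of `Om` on the simplex matter. -/
structure IsGeneralizedNegentropy {N : ℕ} (Om : (Fin N → ℝ) → ℝ) : Prop where
  zero_oneHot : ∀ i : Fin N, Om (Pi.single i 1) = 0
  strictConvexOn : StrictConvexOn ℝ (stdSimplex ℝ (Fin N)) Om
  perm_invariant : ∀ (s : Equiv.Perm (Fin N)), ∀ y ∈ stdSimplex ℝ (Fin N), Om (y ∘ s) = Om y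

/-- The Fenchel conjugate of `Om`, regarded as a function with domain the probability simplex.
(For a convex `Om` the supremum is over a set that is bounded above.) -/
def fenchelConj {N : ℕ} (Om : (Fin N → ℝ) → ℝ) (θ : Fin N → ℝ) : ℝ :=
  ⨆ y : stdSimplex ℝ (Fin N), (θ ⬝ᵥ y.1 - Om y.1)

/-- The Fenchel-Young loss induced by `Om`. -/
def fenchelYoungLoss {N : ℕ} (Om : (Fin N → ℝ) → ℝ) (θ y : Fin N → ℝ) : ℝ :=
  Om y + fenchelConj Om θ - θ ⬝ᵥ y

/-- `m` is the margin of the Fenchel-Young loss of `Om`: the smallest `m ≥ 0` such that the loss of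
`θ` at the one-hot vector `e_i` is zero iff `θ_i` exceeds every other `θ_j` by at least `m`. -/
def HasMargin {N : ℕ} (Om : (Fin N → ℝ) → ℝ) (m : ℝ) : Prop :=
  IsLeast {r : ℝ | 0 ≤ r ∧ ∀ (θ : Fin N → ℝ) (i : Fin N),
    fenchelYoungLoss Om θ (Pi.single i 1) = 0 ↔ ∀ j, j ≠ i → r ≤ θ i - θ j} m

/-- `y` maximizes `θᵀ y - Om y` over the probability simplex. -/
def IsRegularizedArgmax {N : ℕ} (Om : (Fin N → ℝ) → ℝ) (θ y : Fin N → ℝ) : Prop :=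
  y ∈ stdSimplex ℝ (Fin N) ∧
    IsMaxOn (fun z : Fin N → ℝ => θ ⬝ᵥ z - Om z) (stdSimplex ℝ (Fin N)) y

open Classical in
/-- The regularized argmax transformation: the maximizer (unique when `Om` is strictly convex) of
`θᵀ y - Om y` over the simplex. The value `0`, which is not in the simplex, is used only if there is
no maximizer; this cannot happen when `Om` is lower semicontinuous and `N ≥ 1`. -/
def regularizedArgmax {N : ℕ} (Om : (Fin N → ℝ) → ℝ) (θ : Fin N → ℝ) : Fin N → ℝ :=
  if h : ∃ y, IsRegularizedArgmax Om θ y then h.choose else 0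

/-- The update rule `q ↦ Xᵀ ŷ(β X q)` of the Hopfield-Fenchel-Young network with regularizer `Om`,
inverse temperature `β` and patterns `X 0, …, X (N-1)` (the rows of the matrix `X`). -/
def hfyUpdate {N D : ℕ} (Om : (Fin N → ℝ) → ℝ) (β : ℝ) (X : Fin N → EuclideanSpace ℝ (Fin D))
    (q : EuclideanSpace ℝ (Fin D)) : EuclideanSpace ℝ (Fin D) :=
  ∑ i, regularizedArgmax Om (fun j => β * inner ℝ (X j) q) i • X i

/-- The network stores the patterns `X` and retrieves each of them exactly in one iteration under
`ε`-perturbations: the patterns are pairwise distinct, and from every query at distance at most `ε`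
from the pattern `X i` the iterates equal `X i` from the first one on. -/
def StoresExactlyInOneIteration {N D : ℕ} (Om : (Fin N → ℝ) → ℝ) (β : ℝ)
    (X : Fin N → EuclideanSpace ℝ (Fin D)) (ε : ℝ) : Prop :=
  Function.Injective X ∧
    ∀ (i : Fin N) (q : EuclideanSpace ℝ (Fin D)), ‖q - X i‖ ≤ ε →
      ∀ T : ℕ, 1 ≤ T → (hfyUpdate Om β X)^[T] q = X i

/-- The smallest angle between two patterns with different indices (`⊤` if there are fewer than two
patterns). -/
def minAngle {N D : ℕ} (X : Fin N → EuclideanSpace ℝ (Fin D)) : EReal :=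
  ⨅ (i : Fin N) (j : Fin N) (_ : i ≠ j), ((InnerProductGeometry.angle (X i) (X j) : ℝ) : EReal)

/-- `N` patterns are optimally placed on the sphere of radius `M`: they are on this sphere and their
smallest angle is the largest that `N` points of the sphere can have. -/
def IsOptimalPlacement {N D : ℕ} (M : ℝ) (X : Fin N → EuclideanSpace ℝ (Fin D)) : Prop :=
  (∀ i, ‖X i‖ = M) ∧
    ∀ Y : Fin N → EuclideanSpace ℝ (Fin D), (∀ i, ‖Y i‖ = M) → minAngle Y ≤ minAngle X

/-- The uniform probability distribution on the sphere of radius `M` centred at the origin of `ℝ^D`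
(for `D ≥ 1` and `M > 0`): the normalized surface measure of the unit sphere, scaled by `M`. -/
def uniformOnSphere (D : ℕ) (M : ℝ) : Measure (EuclideanSpace ℝ (Fin D)) :=
  Measure.map (fun u : Metric.sphere (0 : EuclideanSpace ℝ (Fin D)) 1 =>
      M • (u : EuclideanSpace ℝ (Fin D)))
    (((volume : Measure (EuclideanSpace ℝ (Fin D))).toSphere Set.univ)⁻¹ •
      (volume : Measure (EuclideanSpace ℝ (Fin D))).toSphere)

end

/-!
The loss at a one-hot vector `eᵢ` vanishes only if `eᵢ` maximizes `θᵀ y - Ω y`, and by strict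
convexity it is then the only maximizer. So the update maps `q` to `xᵢ` as soon as
`β ⟪xᵢ - xⱼ, q⟫ ≥ m` for all `j ≠ i`. If `⟪xᵢ, xⱼ⟫ ≤ κ M²` for all `i ≠ j`, Cauchy-Schwarz gives
this for `‖q - xᵢ‖ ≤ ε` whenever `ε ≤ M / 2 (1 - κ) - m / (2 β M)`
(`storesExactlyInOneIteration_of_inner_le`). Both parts thus reduce to bounding the pairwise inner
products, and both bounds come from the volume of spherical sectors, which are covered by balls.

For optimal placements `κ = 1 / 2`. The sector of half-angle `π / 3` lies in a ball of radius
`√3 / 2`, so fewer than `(2 / √3) ^ D` such caps do not cover the sphere, and a greedy choice yields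
`N ≤ (2 / √3) ^ D` points with pairwise angles at least `π / 3` (`exists_packing_inner_le_half`).
An optimal placement, which exists by compactness, does at least as well. This gives `c = 1`.

For random patterns `κ = cos α` with `α = 1 / ζ`. A cap of half-angle `α ≤ 1` has probability at
most `4 α ^ (D - 1)` (`volume_sphericalSector_cos_le`): the outer shell of relative width `α / √D`
carries at least the fraction `α / 2` of the sector, and it lies in a ball of radius at most
`α √(1 + 1 / D)`, whose volume is at most `2 α ^ D` times that of the unit ball. A union bound over
the at most `N ^ 2` ordered pairs gives `C = 1 / 2`; for `ζ < 1` there are no patterns.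
-/

/-! ### Margins and exact retrieval -/

/-- Averaging the cyclic shifts of `y` gives the barycentre of the simplex, so by convexity and
permutation invariance a generalized negentropy is smallest at the barycentre. -/
theorem IsGeneralizedNegentropy.barycentre_le {N : ℕ} [NeZero N] {Om : (Fin N → ℝ) → ℝ}
    (h : IsGeneralizedNegentropy Om) {y : Fin N → ℝ} (hy : y ∈ stdSimplex ℝ (Fin N)) :
    Om (fun _ => (N : ℝ)⁻¹) ≤ Om y := by
  have hN : (N : ℝ) ≠ 0 := Nat.cast_ne_zero.2 (NeZero.ne N)
  have hJ := h.strictConvexOn.convexOn.map_sum_le (t := Finset.univ)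
    (w := fun _ : Fin N => (N : ℝ)⁻¹) (p := fun k : Fin N => y ∘ Equiv.addRight k)
    (fun _ _ => by positivity) (by simp [hN])
    (fun k _ => ⟨fun i => hy.1 _, by
      simpa using (Equiv.sum_comp (Equiv.addRight k) y).trans hy.2⟩)
  have hbary : ∑ k : Fin N, (N : ℝ)⁻¹ • (y ∘ Equiv.addRight k) = fun _ => (N : ℝ)⁻¹ := by
    funext i
    have : ∑ k : Fin N, y (i + k) = 1 := (Equiv.sum_comp (Equiv.addLeft i) y).trans hy.2
    simp [Finset.sum_apply, ← Finset.mul_sum, this]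
  rw [hbary] at hJ
  simp only [fun k : Fin N => h.perm_invariant (Equiv.addRight k) y hy] at hJ
  simpa [hN] using hJ

/-- The supremum defining the Fenchel conjugate is over a bounded set, hence not a junk value. -/
theorem IsGeneralizedNegentropy.bddAbove_range {N : ℕ} {Om : (Fin N → ℝ) → ℝ}
    (h : IsGeneralizedNegentropy Om) (θ : Fin N → ℝ) :
    BddAbove (Set.range fun y : stdSimplex ℝ (Fin N) => θ ⬝ᵥ y.1 - Om y.1) := by
  refine ⟨∑ j, |θ j| - Om (fun _ => (N : ℝ)⁻¹), ?_⟩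
  rintro _ ⟨⟨y, hy⟩, rfl⟩
  have hN : NeZero N := ⟨by rintro rfl; simpa using hy.2⟩
  refine sub_le_sub (Finset.sum_le_sum fun j _ => ?_) (h.barycentre_le hy)
  have hy1 : y j ≤ 1 := (Finset.single_le_sum (fun k _ => hy.1 k) (Finset.mem_univ j)).trans hy.2.le
  calc θ j * y j ≤ |θ j| * y j := mul_le_mul_of_nonneg_right (le_abs_self _) (hy.1 j)
    _ ≤ |θ j| := mul_le_of_le_one_right (abs_nonneg _) hy1

/-- A zero of the Fenchel-Young loss is a regularized argmax. -/
theorem IsGeneralizedNegentropy.isRegularizedArgmax_of_loss_eq_zero {N : ℕ}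
    {Om : (Fin N → ℝ) → ℝ} (h : IsGeneralizedNegentropy Om) {θ y : Fin N → ℝ}
    (hy : y ∈ stdSimplex ℝ (Fin N)) (h0 : fenchelYoungLoss Om θ y = 0) :
    IsRegularizedArgmax Om θ y := by
  refine ⟨hy, fun z hz => ?_⟩
  have := le_ciSup (h.bddAbove_range θ) ⟨z, hz⟩
  simp only [fenchelYoungLoss, fenchelConj, Set.mem_ofPred_eq] at *
  linarith

theorem IsRegularizedArgmax.regularizedArgmax_eq {N : ℕ} {Om : (Fin N → ℝ) → ℝ}
    (h : IsGeneralizedNegentropy Om) {θ y : Fin N → ℝ} (hy : IsRegularizedArgmax Om θ y) :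
    regularizedArgmax Om θ = y := by
  have hex : ∃ y, IsRegularizedArgmax Om θ y := ⟨y, hy⟩
  have hconc : StrictConcaveOn ℝ (stdSimplex ℝ (Fin N)) (fun z => θ ⬝ᵥ z - Om z) :=
    (((dotProductBilin ℝ ℝ θ).concaveOn (convex_stdSimplex ℝ (Fin N))).sub_strictConvexOn
      h.strictConvexOn)
  rw [regularizedArgmax, dif_pos hex]
  exact hconc.eq_of_isMaxOn hex.choose_spec.2 hy.2 hex.choose_spec.1 hy.1

/-- If the score of pattern `i` exceeds all others by the margin, the update returns it exactly. -/
theorem hfyUpdate_eq_of_margin {N D : ℕ} {Om : (Fin N → ℝ) → ℝ} {m β : ℝ}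
    (h : IsGeneralizedNegentropy Om) (hm : HasMargin Om m)
    (X : Fin N → EuclideanSpace ℝ (Fin D)) (q : EuclideanSpace ℝ (Fin D)) (i : Fin N)
    (hq : ∀ j, j ≠ i → m ≤ β * inner ℝ (X i) q - β * inner ℝ (X j) q) :
    hfyUpdate Om β X q = X i := by
  have h0 := (hm.1.2 (fun j => β * inner ℝ (X j) q) i).2 hq
  rw [hfyUpdate, (h.isRegularizedArgmax_of_loss_eq_zero
    (single_mem_stdSimplex ℝ i) h0).regularizedArgmax_eq h]
  simp [Pi.single_apply]

/-- Patterns on the sphere whose pairwise inner products are at most `κ M²` are retrieved exactly: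
the query `q` satisfies `⟪xᵢ - xⱼ, q⟫ ≥ (1 - κ) M² - 2 M ε ≥ m / β`. -/
theorem storesExactlyInOneIteration_of_inner_le {N D : ℕ} {Om : (Fin N → ℝ) → ℝ} {M m β ε κ : ℝ}
    (h : IsGeneralizedNegentropy Om) (hm : HasMargin Om m) (hM : 0 < M) (hβ : 0 < β)
    (hκ : κ < 1) (hε0 : 0 ≤ ε) (hε : ε ≤ M / 2 * (1 - κ) - m / (2 * β * M))
    {X : Fin N → EuclideanSpace ℝ (Fin D)} (hX : ∀ i, ‖X i‖ = M)
    (hin : ∀ i j, i ≠ j → inner ℝ (X i) (X j) ≤ κ * M ^ 2) :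
    StoresExactlyInOneIteration Om β X ε := by
  have hstep : ∀ (i : Fin N) (q : EuclideanSpace ℝ (Fin D)), ‖q - X i‖ ≤ ε →
      hfyUpdate Om β X q = X i := by
    intro i q hq
    refine hfyUpdate_eq_of_margin h hm X q i fun j hj => ?_
    have hexp : inner ℝ (X i) q - inner ℝ (X j) q =
        inner ℝ (X i) (X i) - inner ℝ (X i) (X j) - inner ℝ (X j - X i) (q - X i) := by
      simp only [inner_sub_left, inner_sub_right, real_inner_comm (X i) (X j)]
      ring
    have hself : inner ℝ (X i) (X i) = M ^ 2 := by rw [real_inner_self_eq_norm_sq, hX]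
    have hcs : inner ℝ (X j - X i) (q - X i) ≤ 2 * M * ε := by
      refine (real_inner_le_norm _ _).trans (mul_le_mul ?_ hq (norm_nonneg _) (by positivity))
      refine (norm_sub_le _ _).trans ?_
      rw [hX, hX]
      linarith
    have hm' : m = 2 * β * M * (m / (2 * β * M)) := by field_simp
    have hscaled := mul_le_mul_of_nonneg_left hε (by positivity : 0 ≤ 2 * β * M)
    have hβin := mul_le_mul_of_nonneg_left (hin i j hj.symm) hβ.le
    have hβcs := mul_le_mul_of_nonneg_left hcs hβ.le
    rw [← mul_sub, hexp, hself]
    linarith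
  refine ⟨fun i j hij => ?_, fun i q hq T hT => ?_⟩
  · by_contra hne
    have := hin i j hne
    rw [← hij, real_inner_self_eq_norm_sq, hX] at this
    nlinarith [pow_pos hM 2]
  · obtain ⟨T, rfl⟩ := Nat.exists_eq_add_of_le' hT
    rw [Function.iterate_succ_apply, hstep i q hq]
    exact Function.iterate_fixed (hstep i (X i) (by simpa using hε0)) T

/-! ### Volumes of spherical sectors -/

/-- The sector of the open unit ball, with its centre removed, that consists of the points whose
angle to the unit vector `u` has a cosine larger than `κ`. -/
def sphericalSector {D : ℕ} (u : EuclideanSpace ℝ (Fin D)) (κ : ℝ) :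
    Set (EuclideanSpace ℝ (Fin D)) :=
  {x | 0 < ‖x‖ ∧ ‖x‖ < 1 ∧ κ * ‖x‖ < inner ℝ u x}

theorem sphericalSector_subset_ball {D : ℕ} (u : EuclideanSpace ℝ (Fin D)) (κ : ℝ) :
    sphericalSector u κ ⊆ Metric.ball 0 1 := fun x hx => by simpa using hx.2.1

theorem norm_sub_smul_sq {D : ℕ} {u : EuclideanSpace ℝ (Fin D)} (hu : ‖u‖ = 1) (κ : ℝ)
    (x : EuclideanSpace ℝ (Fin D)) :
    ‖x - κ • u‖ ^ 2 = ‖x‖ ^ 2 - 2 * κ * inner ℝ u x + κ ^ 2 := by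
  rw [norm_sub_sq_real, norm_smul, hu, real_inner_smul_right, real_inner_comm, mul_one,
    Real.norm_eq_abs, sq_abs]
  ring

theorem volume_real_closedBall {D : ℕ} (x : EuclideanSpace ℝ (Fin D)) {r : ℝ} (hr : 0 ≤ r) :
    volume.real (Metric.closedBall x r) =
      r ^ D * volume.real (Metric.ball (0 : EuclideanSpace ℝ (Fin D)) 1) := by
  simpa using Measure.addHaar_real_closedBall (volume : Measure (EuclideanSpace ℝ (Fin D))) x hr

/-- The sector of half-angle `π / 3` lies in the ball with centre `u / 2` and radius `√3 / 2`. -/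
theorem volume_sphericalSector_half_le {D : ℕ} {u : EuclideanSpace ℝ (Fin D)} (hu : ‖u‖ = 1) :
    volume.real (sphericalSector u (1 / 2)) ≤
      (Real.sqrt 3 / 2) ^ D * volume.real (Metric.ball (0 : EuclideanSpace ℝ (Fin D)) 1) := by
  rw [← volume_real_closedBall ((1 / 2 : ℝ) • u) (by positivity)]
  refine measureReal_mono (fun x ⟨hx0, hx1, hx⟩ => ?_) (measure_closedBall_lt_top.ne)
  rw [mem_closedBall_iff_norm]
  refine abs_le_of_sq_le_sq' ?_ (by positivity) |>.2
  rw [norm_sub_smul_sq hu, div_pow (Real.sqrt 3), Real.sq_sqrt (by norm_num)]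
  nlinarith

open scoped Pointwise in
/-- The part of the sector outside radius `1 - s` lies in a ball of radius `√(1 - κ² + s²)` about
`κ • u`, while by homogeneity it carries the fraction `1 - (1 - s) ^ D` of the sector. -/
theorem one_sub_pow_mul_volume_sphericalSector_le {D : ℕ}
    {u : EuclideanSpace ℝ (Fin D)} (hu : ‖u‖ = 1) {κ s : ℝ} (hκ0 : 0 ≤ κ) (hκ1 : κ ≤ 1)
    (hs1 : s ≤ 1) :
    (1 - (1 - s) ^ D) * volume.real (sphericalSector u κ) ≤
      Real.sqrt (1 - κ ^ 2 + s ^ 2) ^ D *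
        volume.real (Metric.ball (0 : EuclideanSpace ℝ (Fin D)) 1) := by
  have hfin : volume (sphericalSector u κ) ≠ ⊤ :=
    ((measure_mono (sphericalSector_subset_ball u κ)).trans_lt measure_ball_lt_top).ne
  have hcover : sphericalSector u κ ⊆ (1 - s) • sphericalSector u κ ∪
      Metric.closedBall (κ • u) (Real.sqrt (1 - κ ^ 2 + s ^ 2)) := by
    rintro x ⟨hx0, hx1, hx⟩
    rcases lt_or_ge ‖x‖ (1 - s) with hlt | hge
    · left
      have hs : 0 < 1 - s := hx0.trans hlt
      refine ⟨(1 - s)⁻¹ • x, ?_, by simp [smul_smul, hs.ne']⟩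
      simp only [sphericalSector, Set.mem_ofPred_eq, norm_smul, norm_inv, Real.norm_eq_abs,
        abs_of_pos hs, real_inner_smul_right]
      refine ⟨by positivity, by rwa [inv_mul_lt_one₀ hs], ?_⟩
      rw [mul_left_comm]
      exact mul_lt_mul_of_pos_left hx (inv_pos.2 hs)
    · right
      rw [mem_closedBall_iff_norm]
      refine Real.le_sqrt_of_sq_le ?_
      rw [norm_sub_smul_sq hu]
      have h1 : κ * (κ * ‖x‖) ≤ κ * inner ℝ u x := mul_le_mul_of_nonneg_left hx.le hκ0
      have h2 : (1 - ‖x‖) ^ 2 ≤ s ^ 2 := by gcongr; linarith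
      nlinarith [mul_nonneg (sub_nonneg.2 hx1.le) (by nlinarith : 0 ≤ 1 - κ ^ 2)]
  have hsub : volume.real (sphericalSector u κ) ≤
      volume.real ((1 - s) • sphericalSector u κ) +
        volume.real (Metric.closedBall (κ • u) (Real.sqrt (1 - κ ^ 2 + s ^ 2))) := by
    refine (measureReal_mono hcover ?_).trans (measureReal_union_le _ _)
    refine (measure_union_lt_top ?_ measure_closedBall_lt_top).ne
    rw [Measure.addHaar_smul]
    exact ENNReal.mul_lt_top (by simp) hfin.lt_top
  have hscale : volume.real ((1 - s) • sphericalSector u κ) =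
      (1 - s) ^ D * volume.real (sphericalSector u κ) := by
    have := sub_nonneg.2 hs1
    rw [measureReal_def, Measure.addHaar_smul, ENNReal.toReal_mul, finrank_euclideanSpace_fin,
      ENNReal.toReal_ofReal (abs_nonneg _), abs_of_nonneg (by positivity), measureReal_def]
  rw [volume_real_closedBall _ (Real.sqrt_nonneg _), hscale] at hsub
  linarith

/-- The sector of half-angle `α ≤ 1` has at most the fraction `4 α ^ (D - 1)` of the volume of the
unit ball. -/
theorem volume_sphericalSector_cos_le {D : ℕ} (hD : 1 ≤ D)
    {u : EuclideanSpace ℝ (Fin D)} (hu : ‖u‖ = 1) {α : ℝ} (hα0 : 0 < α) (hα1 : α ≤ 1) :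
    volume.real (sphericalSector u (Real.cos α)) ≤
      4 * α ^ (D - 1) * volume.real (Metric.ball (0 : EuclideanSpace ℝ (Fin D)) 1) := by
  set V := volume.real (Metric.ball (0 : EuclideanSpace ℝ (Fin D)) 1)
  set S := volume.real (sphericalSector u (Real.cos α))
  have hV : 0 ≤ V := measureReal_nonneg
  have hS : 0 ≤ S := measureReal_nonneg
  have hD' : (1 : ℝ) ≤ D := by exact_mod_cast hD
  set d := Real.sqrt D
  have hd1 : 1 ≤ d := Real.one_le_sqrt.2 hD'
  have hdd : d ^ 2 = D := Real.sq_sqrt (by positivity)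
  -- This width makes the shell a fixed multiple of `α` of the sector for small `α`, while
  -- enlarging the covering ball by a bounded factor only.
  set s := α / d with hs
  have hs0 : 0 < s := by positivity
  have hs1 : s ≤ 1 := (div_le_one (by positivity)).2 (hα1.trans hd1)
  have hmain := one_sub_pow_mul_volume_sphericalSector_le hu
    (Real.cos_nonneg_of_neg_pi_div_two_le_of_le (by linarith [Real.pi_pos])
      (by linarith [Real.pi_gt_three])) (Real.cos_le_one α) hs1
  have hDs : D * s = α * d := by rw [hs, ← hdd]; field_simp
  have hfrac : α / 2 ≤ 1 - (1 - s) ^ D := by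
    have hB := one_add_mul_le_pow (by linarith : (-2 : ℝ) ≤ s) D
    have hprod : (1 - s) ^ D * (1 + s) ^ D ≤ 1 := by
      rw [← mul_pow]
      exact pow_le_one₀ (by nlinarith) (by nlinarith)
    have hp0 : 0 ≤ (1 - s) ^ D := pow_nonneg (by linarith) D
    have h1 : (1 - s) ^ D * (1 + α * d) ≤ 1 := by
      rw [← hDs]; exact (mul_le_mul_of_nonneg_left hB hp0).trans hprod
    have h2 : 1 ≤ (1 - α / 2) * (1 + α * d) := by
      nlinarith [mul_nonneg hα0.le (sub_nonneg.2 hd1),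
        mul_nonneg (mul_nonneg hα0.le (sub_nonneg.2 hα1)) (by linarith : 0 ≤ d)]
    have h3 : 0 < 1 + α * d := by positivity
    have := le_of_mul_le_mul_right (h1.trans h2) h3
    linarith
  have hrad : Real.sqrt (1 - Real.cos α ^ 2 + s ^ 2) ^ D ≤ 2 * α ^ D := by
    have hsin : 1 - Real.cos α ^ 2 ≤ α ^ 2 := by
      have := Real.sin_sq_le_sq (x := α)
      nlinarith [Real.sin_sq_add_cos_sq α]
    have h1 : Real.sqrt (1 - Real.cos α ^ 2 + s ^ 2) ≤ α * Real.exp (1 / (2 * D)) := by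
      refine Real.sqrt_le_iff.2 ⟨by positivity, ?_⟩
      have he : 1 + 1 / (D : ℝ) ≤ Real.exp (1 / (2 * D)) ^ 2 := by
        rw [← Real.exp_nat_mul]
        have := Real.add_one_le_exp (1 / (D : ℝ))
        calc 1 + 1 / (D : ℝ) ≤ Real.exp (1 / D) := by linarith
          _ = _ := by congr 1; push_cast; field_simp
      have hs2 : s ^ 2 = α ^ 2 * (1 / D) := by rw [hs, div_pow, hdd]; ring
      rw [mul_pow]
      nlinarith [mul_le_mul_of_nonneg_left he (sq_nonneg α)]
    have h2 : Real.exp (1 / (2 * D)) ^ D ≤ 2 := by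
      rw [← Real.exp_nat_mul]
      have : (D : ℝ) * (1 / (2 * D)) = 1 / 2 := by field_simp
      rw [this]
      refine abs_le_of_sq_le_sq' ?_ (by norm_num) |>.2
      rw [← Real.exp_nat_mul]
      have := Real.exp_one_lt_d9
      norm_num at this ⊢
      linarith
    calc _ ≤ (α * Real.exp (1 / (2 * D))) ^ D := by gcongr
      _ = α ^ D * Real.exp (1 / (2 * D)) ^ D := mul_pow _ _ _
      _ ≤ α ^ D * 2 := by gcongr
      _ = _ := mul_comm _ _
  have hpow : α ^ D = α * α ^ (D - 1) := (mul_pow_sub_one (by omega) α).symm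
  have hchain : α / 2 * S ≤ α / 2 * (4 * α ^ (D - 1) * V) := by
    calc α / 2 * S ≤ (1 - (1 - s) ^ D) * S := by gcongr
      _ ≤ _ := hmain
      _ ≤ 2 * α ^ D * V := by gcongr
      _ = _ := by rw [hpow]; ring
  exact le_of_mul_le_mul_left hchain (by positivity)

/-! ### Optimal placements -/

/-- Fewer than `(2 / √3) ^ D` caps of half-angle `π / 3` do not cover the unit sphere. -/
theorem exists_norm_eq_one_forall_inner_le_half {D n : ℕ} (hD : 1 ≤ D)
    (hn : (n : ℝ) < (2 / Real.sqrt 3) ^ D) {Y : Fin n → EuclideanSpace ℝ (Fin D)}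
    (hY : ∀ i, ‖Y i‖ = 1) :
    ∃ v : EuclideanSpace ℝ (Fin D), ‖v‖ = 1 ∧ ∀ i, inner ℝ (Y i) v ≤ 1 / 2 := by
  by_contra! hcon
  have : Nonempty (Fin D) := ⟨⟨0, hD⟩⟩
  set V := volume.real (Metric.ball (0 : EuclideanSpace ℝ (Fin D)) 1)
  have hV : 0 < V := ENNReal.toReal_pos
    (Metric.measure_ball_pos volume _ one_pos).ne' measure_ball_lt_top.ne
  have hcover : Metric.ball (0 : EuclideanSpace ℝ (Fin D)) 1 \ {0} ⊆
      ⋃ i, sphericalSector (Y i) (1 / 2) := by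
    rintro x ⟨hx1, hx0⟩
    have hx0 : 0 < ‖x‖ := norm_pos_iff.2 hx0
    obtain ⟨i, hi⟩ := hcon (‖x‖⁻¹ • x) (by simp [norm_smul, hx0.ne'])
    refine Set.mem_iUnion.2 ⟨i, hx0, by simpa using hx1, ?_⟩
    rwa [real_inner_smul_right, ← div_eq_inv_mul, lt_div_iff₀ hx0] at hi
  have hVle : V ≤ n * ((Real.sqrt 3 / 2) ^ D * V) := by
    calc V = volume.real (Metric.ball (0 : EuclideanSpace ℝ (Fin D)) 1 \ {0}) := by
          rw [measureReal_def, measure_sdiff_null (measure_singleton _)]; rfl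
      _ ≤ volume.real (⋃ i, sphericalSector (Y i) (1 / 2)) :=
          measureReal_mono hcover ((measure_mono (Set.iUnion_subset fun i =>
            sphericalSector_subset_ball _ _)).trans_lt measure_ball_lt_top).ne
      _ ≤ ∑ i, volume.real (sphericalSector (Y i) (1 / 2)) := measureReal_iUnion_fintype_le _
      _ ≤ ∑ _i : Fin n, (Real.sqrt 3 / 2) ^ D * V :=
          Finset.sum_le_sum fun i _ => volume_sphericalSector_half_le (hY i)
      _ = _ := by simp
  have hlt : (n : ℝ) * (Real.sqrt 3 / 2) ^ D < 1 := by
    calc (n : ℝ) * (Real.sqrt 3 / 2) ^ D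
        < (2 / Real.sqrt 3) ^ D * (Real.sqrt 3 / 2) ^ D := by gcongr
      _ = 1 := by rw [← mul_pow, div_mul_div_cancel₀ (by positivity)]; norm_num
  nlinarith

theorem exists_packing_inner_le_half {D : ℕ} (hD : 1 ≤ D) (n : ℕ)
    (hn : (n : ℝ) ≤ (2 / Real.sqrt 3) ^ D) :
    ∃ Y : Fin n → EuclideanSpace ℝ (Fin D), (∀ i, ‖Y i‖ = 1) ∧
      ∀ i j, i ≠ j → inner ℝ (Y i) (Y j) ≤ 1 / 2 := by
  induction n with
  | zero => exact ⟨Fin.elim0, fun i => i.elim0, fun i => i.elim0⟩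
  | succ n ih =>
    have hn' : (n : ℝ) < (2 / Real.sqrt 3) ^ D := by push_cast at hn; linarith
    obtain ⟨Y, hY, hin⟩ := ih hn'.le
    obtain ⟨v, hv, hvY⟩ := exists_norm_eq_one_forall_inner_le_half hD hn' hY
    refine ⟨Fin.cons v Y, Fin.cases (by simpa using hv) (by simpa using hY), fun i j => ?_⟩
    refine Fin.cases ?_ (fun i => ?_) i <;> refine Fin.cases ?_ (fun j => ?_) j
    · simp
    · intro _
      simpa [real_inner_comm] using hvY j
    · intro _
      simpa using hvY i
    · intro hij
      simpa using hin i j (by simpa using hij)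

theorem coe_le_minAngle_iff {N D : ℕ} {X : Fin N → EuclideanSpace ℝ (Fin D)} {a : ℝ} :
    (a : EReal) ≤ minAngle X ↔
      ∀ i j, i ≠ j → a ≤ InnerProductGeometry.angle (X i) (X j) := by
  simp [minAngle, le_iInf_iff]

/-- Optimal placements exist because the configurations form a compact set, on which the smallest
angle is upper semicontinuous. -/
theorem exists_isOptimalPlacement {D : ℕ} (hD : 1 ≤ D) (N : ℕ) {M : ℝ} (hM : 0 < M) :
    ∃ X : Fin N → EuclideanSpace ℝ (Fin D), IsOptimalPlacement M X := by
  have : Nonempty (Fin D) := ⟨⟨0, hD⟩⟩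
  set K : Set (Fin N → EuclideanSpace ℝ (Fin D)) :=
    Set.univ.pi fun _ => Metric.sphere (0 : EuclideanSpace ℝ (Fin D)) M
  have hmem : ∀ X : Fin N → EuclideanSpace ℝ (Fin D), X ∈ K ↔ ∀ i, ‖X i‖ = M := by
    simp [K, Set.mem_pi]
  have hne : K.Nonempty := Set.univ_pi_nonempty_iff.2 fun _ => NormedSpace.sphere_nonempty.2 hM.le
  have husc : UpperSemicontinuousOn (minAngle (N := N) (D := D)) K := by
    refine upperSemicontinuousOn_iInf fun i => upperSemicontinuousOn_iInf fun j =>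
      upperSemicontinuousOn_iInf fun _ => ContinuousOn.upperSemicontinuousOn fun X hX => ?_
    have h0 : ∀ k, X k ≠ 0 := fun k => norm_pos_iff.1 (((hmem X).1 hX k).symm ▸ hM)
    have hang : ContinuousAt
        (fun X : Fin N → EuclideanSpace ℝ (Fin D) => InnerProductGeometry.angle (X i) (X j)) X :=
      ContinuousAt.comp (f := fun X : Fin N → EuclideanSpace ℝ (Fin D) => (X i, X j))
        (InnerProductGeometry.continuousAt_angle (x := (X i, X j)) (h0 i) (h0 j))
        (by fun_prop)
    exact (continuous_coe_real_ereal.continuousAt.comp hang).continuousWithinAt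
  obtain ⟨X, hX, hmax⟩ := husc.exists_isMaxOn hne (isCompact_univ_pi fun _ => isCompact_sphere _ _)
  exact ⟨X, (hmem X).1 hX, fun Y hY => hmax ((hmem Y).2 hY)⟩

/-- Up to `(2 / √3) ^ D` optimally placed patterns have pairwise angles of at least `π / 3`. -/
theorem IsOptimalPlacement.inner_le {N D : ℕ} (hD : 1 ≤ D)
    (hN : (N : ℝ) ≤ (2 / Real.sqrt 3) ^ D) {M : ℝ} (hM : 0 < M)
    {X : Fin N → EuclideanSpace ℝ (Fin D)} (hX : IsOptimalPlacement M X) {i j : Fin N}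
    (hij : i ≠ j) : inner ℝ (X i) (X j) ≤ 1 / 2 * M ^ 2 := by
  obtain ⟨Y, hY, hin⟩ := exists_packing_inner_le_half hD N hN
  have hpack : ((Real.pi / 3 : ℝ) : EReal) ≤ minAngle fun k => M • Y k := by
    refine coe_le_minAngle_iff.2 fun k l hkl => ?_
    rw [InnerProductGeometry.angle_smul_smul hM.ne', InnerProductGeometry.angle, hY, hY,
      ← Real.arccos_cos (x := Real.pi / 3) (by positivity) (by linarith [Real.pi_pos]),
      Real.cos_pi_div_three]
    exact Real.arccos_le_arccos (by simpa using hin k l hkl)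
  have hang := coe_le_minAngle_iff.1 (hpack.trans
    (hX.2 (fun k => M • Y k) fun k => by simp [norm_smul, hY, abs_of_pos hM])) i j hij
  have hcos := Real.cos_le_cos_of_nonneg_of_le_pi (by positivity)
    (InnerProductGeometry.angle_le_pi _ _) hang
  rw [Real.cos_pi_div_three] at hcos
  rw [← InnerProductGeometry.cos_angle_mul_norm_mul_norm, hX.1, hX.1]
  nlinarith [pow_pos hM 2]

/-! ### Independent uniform patterns -/

theorem isProbabilityMeasure_uniformOnSphere {D : ℕ} (hD : 1 ≤ D) (M : ℝ) :
    IsProbabilityMeasure (uniformOnSphere D M) := by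
  have : Nonempty (Fin D) := ⟨⟨0, hD⟩⟩
  have : NeZero (volume : Measure (EuclideanSpace ℝ (Fin D))).toSphere :=
    ⟨Measure.toSphere_ne_zero _⟩
  exact Measure.isProbabilityMeasure_map (by fun_prop)

theorem ae_uniformOnSphere_norm_eq (D : ℕ) {M : ℝ} (hM : 0 < M) :
    ∀ᵐ x ∂uniformOnSphere D M, ‖x‖ = M := by
  rw [uniformOnSphere, ae_map_iff (by fun_prop) (measurableSet_eq_fun (by fun_prop) (by fun_prop))]
  refine Filter.Eventually.of_forall fun u => ?_
  simp [norm_smul, abs_of_pos hM]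

open scoped Pointwise in
/-- The uniform measure of a cap is the volume fraction of its sector. -/
theorem uniformOnSphere_cap_le {D : ℕ} (hD : 1 ≤ D) {M α : ℝ} (hM : 0 < M) (hα0 : 0 < α)
    (hα1 : α ≤ 1) {x : EuclideanSpace ℝ (Fin D)} (hx : ‖x‖ = M) :
    uniformOnSphere D M {y | Real.cos α * M ^ 2 < inner ℝ x y} ≤
      ENNReal.ofReal (4 * α ^ (D - 1)) := by
  have hu : ‖M⁻¹ • x‖ = 1 := by rw [norm_smul, hx]; simp [abs_of_pos hM, hM.ne']
  have hmeas : Measurable fun u : Metric.sphere (0 : EuclideanSpace ℝ (Fin D)) 1 =>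
      M • (u : EuclideanSpace ℝ (Fin D)) := by fun_prop
  have hset : MeasurableSet {y | Real.cos α * M ^ 2 < inner ℝ x y} :=
    measurableSet_lt (by fun_prop) (by fun_prop)
  have hsub : Set.Ioo (0 : ℝ) 1 • ((↑) '' ((fun u : Metric.sphere
        (0 : EuclideanSpace ℝ (Fin D)) 1 => M • (u : EuclideanSpace ℝ (Fin D))) ⁻¹'
        {y | Real.cos α * M ^ 2 < inner ℝ x y}) : Set (EuclideanSpace ℝ (Fin D))) ⊆
      sphericalSector (M⁻¹ • x) (Real.cos α) := by
    rintro _ ⟨r, hr, _, ⟨u, hmem, rfl⟩, rfl⟩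
    have hnu : ‖(u : EuclideanSpace ℝ (Fin D))‖ = 1 := by simp
    have hru : ‖r • (u : EuclideanSpace ℝ (Fin D))‖ = r := by
      rw [norm_smul, hnu, mul_one, Real.norm_of_nonneg hr.1.le]
    simp only [Set.mem_preimage, Set.mem_ofPred_eq, real_inner_smul_right] at hmem
    refine ⟨hru.symm ▸ hr.1, hru.symm ▸ hr.2, ?_⟩
    simp only [hru, real_inner_smul_left, real_inner_smul_right]
    have hlt : Real.cos α * M < inner ℝ x (u : EuclideanSpace ℝ (Fin D)) := by nlinarith
    rw [mul_comm (Real.cos α)]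
    refine mul_lt_mul_of_pos_left ?_ hr.1
    rwa [← div_eq_inv_mul, lt_div_iff₀ hM]
  have hvol : volume (sphericalSector (M⁻¹ • x) (Real.cos α)) ≤
      ENNReal.ofReal (4 * α ^ (D - 1)) *
        volume (Metric.ball (0 : EuclideanSpace ℝ (Fin D)) 1) := by
    have hfin := ((measure_mono (μ := volume) (sphericalSector_subset_ball (M⁻¹ • x)
      (Real.cos α))).trans_lt measure_ball_lt_top).ne
    rw [← ENNReal.toReal_le_toReal hfin
      (ENNReal.mul_ne_top ENNReal.ofReal_ne_top measure_ball_lt_top.ne), ENNReal.toReal_mul,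
      ENNReal.toReal_ofReal (by positivity)]
    exact volume_sphericalSector_cos_le hD hu hα0 hα1
  rw [uniformOnSphere, Measure.map_apply hmeas hset, Measure.smul_apply, smul_eq_mul, mul_comm,
    ← div_eq_mul_inv, Measure.toSphere_apply_univ, Measure.toSphere_apply' _ (hmeas hset)]
  refine ENNReal.div_le_of_le_mul ?_
  rw [mul_left_comm]
  exact mul_le_mul_right ((measure_mono hsub).trans hvol) _

/-- Two independent uniform patterns have an angle less than `α` with probability at most
`4 α ^ (D - 1)`. -/
theorem pi_uniformOnSphere_pair_le {N D : ℕ} (hD : 1 ≤ D) {M α : ℝ} (hM : 0 < M) (hα0 : 0 < α)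
    (hα1 : α ≤ 1) {i j : Fin N} (hij : i ≠ j) :
    (Measure.pi fun _ : Fin N => uniformOnSphere D M)
      {X | Real.cos α * M ^ 2 < inner ℝ (X i) (X j)} ≤ ENNReal.ofReal (4 * α ^ (D - 1)) := by
  have := isProbabilityMeasure_uniformOnSphere hD M
  set μ := uniformOnSphere D M
  have hind := (ProbabilityTheory.iIndepFun_pi (μ := fun _ : Fin N => μ)
    (X := fun _ => id) (fun _ => aemeasurable_id)).indepFun hij
  have hmap : (Measure.pi fun _ : Fin N => μ).map (fun X => (X i, X j)) = μ.prod μ := by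
    have := (ProbabilityTheory.indepFun_iff_map_prod_eq_prod_map_map
      (measurable_pi_apply i).aemeasurable (measurable_pi_apply j).aemeasurable).1 hind
    exact this.trans (congrArg₂ Measure.prod (measurePreserving_eval (fun _ => μ) i).map_eq
      (measurePreserving_eval (fun _ => μ) j).map_eq)
  have hset : MeasurableSet {z : EuclideanSpace ℝ (Fin D) × EuclideanSpace ℝ (Fin D) |
      Real.cos α * M ^ 2 < inner ℝ z.1 z.2} := measurableSet_lt (by fun_prop) (by fun_prop)
  calc (Measure.pi fun _ : Fin N => μ) {X | Real.cos α * M ^ 2 < inner ℝ (X i) (X j)}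
      = (μ.prod μ) {z | Real.cos α * M ^ 2 < inner ℝ z.1 z.2} := by
        rw [← hmap, Measure.map_apply (by fun_prop) hset]; rfl
    _ = ∫⁻ x, μ {y | Real.cos α * M ^ 2 < inner ℝ x y} ∂μ := Measure.prod_apply hset
    _ ≤ ∫⁻ _, ENNReal.ofReal (4 * α ^ (D - 1)) ∂μ :=
        lintegral_mono_ae <| (ae_uniformOnSphere_norm_eq D hM).mono fun x hx =>
          uniformOnSphere_cap_le hD hM hα0 hα1 hx
    _ = _ := by simp

/-- A union bound over the pairs of patterns. -/
theorem pi_uniformOnSphere_not_stores_le {N D : ℕ} (hD : 1 ≤ D) {M α β m ε : ℝ}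
    {Om : (Fin N → ℝ) → ℝ} (h : IsGeneralizedNegentropy Om) (hm : HasMargin Om m) (hM : 0 < M)
    (hβ : 0 < β) (hα0 : 0 < α) (hα1 : α ≤ 1) (hε0 : 0 ≤ ε)
    (hε : ε ≤ M / 2 * (1 - Real.cos α) - m / (2 * β * M)) :
    (Measure.pi fun _ : Fin N => uniformOnSphere D M)
      {X | ¬ StoresExactlyInOneIteration Om β X ε} ≤
        ENNReal.ofReal ((N : ℝ) ^ 2 * (4 * α ^ (D - 1))) := by
  have := isProbabilityMeasure_uniformOnSphere hD M
  have hcos : Real.cos α < 1 := by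
    simpa using Real.cos_lt_cos_of_nonneg_of_le_pi le_rfl (by linarith [Real.pi_gt_three]) hα0
  have hnorm : ∀ᵐ X ∂(Measure.pi fun _ : Fin N => uniformOnSphere D M), ∀ i, ‖X i‖ = M :=
    ae_all_iff.2 fun i => (measurePreserving_eval (fun _ : Fin N => uniformOnSphere D M)
      i).quasiMeasurePreserving.ae (ae_uniformOnSphere_norm_eq D hM)
  calc (Measure.pi fun _ : Fin N => uniformOnSphere D M)
        {X | ¬ StoresExactlyInOneIteration Om β X ε}
      ≤ (Measure.pi fun _ : Fin N => uniformOnSphere D M)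
          (⋃ k ∈ (Finset.univ : Finset (Fin N)).offDiag,
            {X | Real.cos α * M ^ 2 < inner ℝ (X k.1) (X k.2)}) := by
        refine measure_mono_ae (hnorm.mono fun X hX hbad => ?_)
        by_contra hgood
        refine hbad (storesExactlyInOneIteration_of_inner_le h hm hM hβ hcos hε0 hε hX
          fun i j hij => le_of_not_gt fun hlt => hgood ?_)
        exact Set.mem_biUnion (x := (i, j)) (by simpa using hij) hlt
    _ ≤ ∑ k ∈ (Finset.univ : Finset (Fin N)).offDiag, ENNReal.ofReal (4 * α ^ (D - 1)) :=
        (measure_biUnion_finset_le _ _).trans <| Finset.sum_le_sum fun k hk =>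
          pi_uniformOnSphere_pair_le hD hM hα0 hα1 (Finset.mem_offDiag.1 hk).2.2
    _ ≤ _ := by
        rw [Finset.sum_const, nsmul_eq_mul, ← ENNReal.ofReal_natCast,
          ← ENNReal.ofReal_mul (by positivity)]
        refine ENNReal.ofReal_le_ofReal (mul_le_mul_of_nonneg_right ?_ (by positivity))
        have : (Finset.univ : Finset (Fin N)).offDiag.card ≤ N ^ 2 := by
          simp [Finset.offDiag_card, sq]
        exact_mod_cast this

theorem proposition4p5 :
    -- optimally placed patterns
    (∃ c : ℝ, 0 < c ∧ ∀ D N : ℕ, 1 ≤ D → (N : ℝ) ≤ c * (2 / Real.sqrt 3) ^ D →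
      ∀ (M β m ε : ℝ) (Om : (Fin N → ℝ) → ℝ), 0 < M → 0 < β →
        IsGeneralizedNegentropy Om → HasMargin Om m →
        2 * m / β < M ^ 2 → 0 ≤ ε → ε ≤ M / 4 - m / (2 * β * M) →
        (∃ X : Fin N → EuclideanSpace ℝ (Fin D), IsOptimalPlacement M X) ∧
          ∀ X : Fin N → EuclideanSpace ℝ (Fin D), IsOptimalPlacement M X →
            StoresExactlyInOneIteration Om β X ε) ∧
    -- independent patterns with the uniform distribution: the failure probability is at most `p`
    (∃ C : ℝ, 0 < C ∧ ∀ D N : ℕ, 1 ≤ D → ∀ p ζ : ℝ, 0 ≤ p → p ≤ 1 → 0 < ζ →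
      (N : ℝ) ≤ C * (Real.sqrt p * ζ ^ (((D : ℝ) - 1) / 2)) →
      ∀ (M β m ε : ℝ) (Om : (Fin N → ℝ) → ℝ), 0 < M → 0 < β →
        IsGeneralizedNegentropy Om → HasMargin Om m →
        0 ≤ ε → ε ≤ M / 2 * (1 - Real.cos (1 / ζ)) - m / (2 * β * M) →
        (MeasureTheory.Measure.pi fun _ : Fin N => uniformOnSphere D M)
            {X | ¬ StoresExactlyInOneIteration Om β X ε} ≤ ENNReal.ofReal p) := by
  refine ⟨⟨1, one_pos, ?_⟩, 1 / 2, by norm_num, ?_⟩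
  · intro D N hD hN M β m ε Om hM hβ h hm _ hε0 hε
    rw [one_mul] at hN
    refine ⟨exists_isOptimalPlacement hD N hM, fun X hX => ?_⟩
    exact storesExactlyInOneIteration_of_inner_le (κ := 1 / 2) h hm hM hβ (by norm_num) hε0
      (by linarith) hX.1 fun i j hij => hX.inner_le hD hN hM hij
  · intro D N hD p ζ hp0 hp1 hζ hN M β m ε Om hM hβ h hm hε0 hε
    have hsqrt : Real.sqrt p ≤ 1 := Real.sqrt_le_one.2 hp1
    have hD' : (1 : ℝ) ≤ D := by exact_mod_cast hD
    rcases lt_or_ge ζ 1 with hζ1 | hζ1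
    · -- For `ζ < 1` the bound on `N` leaves no pattern at all.
      have hpow : ζ ^ (((D : ℝ) - 1) / 2) ≤ 1 := Real.rpow_le_one hζ.le hζ1.le (by linarith)
      have hN1 : (N : ℝ) < 1 := by
        nlinarith [mul_le_one₀ hsqrt (by positivity) hpow]
      obtain rfl : N = 0 := by
        have : N < 1 := by exact_mod_cast hN1
        omega
      have hempty : {X : Fin 0 → EuclideanSpace ℝ (Fin D) |
          ¬ StoresExactlyInOneIteration Om β X ε} = ∅ :=
        Set.eq_empty_of_forall_notMem fun X hX =>
          hX ⟨Function.injective_of_subsingleton X, fun i => i.elim0⟩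
      rw [hempty]
      simp
    · refine (pi_uniformOnSphere_not_stores_le hD h hm hM hβ (by positivity)
        ((div_le_one hζ).2 hζ1) hε0 hε).trans (ENNReal.ofReal_le_ofReal ?_)
      have hsq : (ζ ^ (((D : ℝ) - 1) / 2)) ^ 2 = ζ ^ (D - 1) := by
        rw [← Real.rpow_natCast, ← Real.rpow_mul hζ.le, ← Real.rpow_natCast]
        congr 1
        push_cast [Nat.cast_sub hD]
        ring
      calc (N : ℝ) ^ 2 * (4 * (1 / ζ) ^ (D - 1))
          ≤ (1 / 2 * (Real.sqrt p * ζ ^ (((D : ℝ) - 1) / 2))) ^ 2 *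
              (4 * (1 / ζ) ^ (D - 1)) := by gcongr
        _ = p * (ζ ^ (D - 1) * (1 / ζ) ^ (D - 1)) := by
            rw [mul_pow, mul_pow, hsq, Real.sq_sqrt hp0]; ring
        _ = p := by rw [← mul_pow, mul_one_div_cancel hζ.ne', one_pow, mul_one]
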